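/- Equip $\mathbb{R}^{2\times 2\times 2}$ with Lebesgue measure. Write a tensor $X=(X_{ijk})$ as $[X_1\,|\,X_2]$ with slabs $X_k=(X_{ijk})_{i,j}$. The orbit of $X$ is the set of all tensors $(S,T,U)\cdot X$, where $S,T,U$ are invertible real $2\times 2$ matrices and $((S,T,U)\cdot X)_{ijk}=\sum_{p,q,r}S_{ip}T_{jq}U_{kr}X_{pqr}$. Let $G_2$, $D_3$, $G_3$ be the orbits of $$\left[\begin{array}{cc|cc}1&0&0&0\\0&0&0&1\end{array}\right],\qquad \left[\begin{array}{cc|cc}0&1&1&0\\1&0&0&0\end{array}\right],\qquad \left[\begin{array}{cc|cc}-1&0&0&1\\0&1&1&0\end{array}\right],$$ respectively. A best rank-1 approximation of $X$ is a tensor $Y=x\otimes y\otimes z$, with $x,y,z\in\mathbb{R}^2$, that minimizes the Frobenius norm $\|X-Y\|$ among all such outer products. The tensor rank of $X$ is the least number of outer products that sum to $X$. Its multilinear rank is the triple of the dimensions of the spans of its mode-1, mode-2 and mode-3 vectors. Its hyperdeterminant is $$\Delta(X)=\left[\tfrac12\big(\det(X_1+X_2)-\det(X_1-X_2)\big)\right]^2-4\det(X_1)\det(X_2).$$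 **Theorem.** For almost all $X\in\mathbb{R}^{2\times 2\times 2}$ the following holds. Either $X$ lies in $G_2$ and has tensor rank $2$, or $X$ lies in $G_3$ and has tensor rank $3$. Moreover, for every best rank-1 approximation $Y$ of $X$, the difference $X-Y$ lies in $D_3$, its hyperdeterminant is $0$, its multilinear rank is $(2,2,2)$, and its tensor rank is $3$. In particular, for almost all $X$ of tensor rank $2$, subtracting a best rank-1 approximation raises the rank to $3$. -/

import Mathlib

open MeasureTheory

/-- Real tensors of order 3 and format `d₁ × d₂ × d₃`, as arrays `X i j k`. As an iterated finite
product of copies of `ℝ`, this space carries Lebesgue measure `volume`. -/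
abbrev Tensor3 (d₁ d₂ d₃ : ℕ) : Type := Fin d₁ → Fin d₂ → Fin d₃ → ℝ

namespace Tensor3

/-- The outer product `x ⊗ y ⊗ z`. -/
def outer {d₁ d₂ d₃ : ℕ} (x : Fin d₁ → ℝ) (y : Fin d₂ → ℝ) (z : Fin d₃ → ℝ) :
    Tensor3 d₁ d₂ d₃ :=
  fun i j k => x i * y j * z k

/-- The squared Frobenius norm. -/
def frobSq {d₁ d₂ d₃ : ℕ} (X : Tensor3 d₁ d₂ d₃) : ℝ :=
  ∑ i, ∑ j, ∑ k, X i j k ^ 2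

/-- `Y` is a best rank-1 approximation of `X`: it is an outer product of three vectors that
minimizes the Frobenius distance to `X` among all such outer products. -/
def IsBestRankOneApprox {d₁ d₂ d₃ : ℕ} (X Y : Tensor3 d₁ d₂ d₃) : Prop :=
  (∃ (x : Fin d₁ → ℝ) (y : Fin d₂ → ℝ) (z : Fin d₃ → ℝ), Y = outer x y z) ∧
    ∀ (x : Fin d₁ → ℝ) (y : Fin d₂ → ℝ) (z : Fin d₃ → ℝ),
      frobSq (X - Y) ≤ frobSq (X - outer x y z)

/-- The tensor rank: the least number of outer products whose sum is `X`. -/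
noncomputable def rank {d₁ d₂ d₃ : ℕ} (X : Tensor3 d₁ d₂ d₃) : ℕ :=
  sInf {R : ℕ | ∃ (a : Fin R → Fin d₁ → ℝ) (b : Fin R → Fin d₂ → ℝ) (c : Fin R → Fin d₃ → ℝ),
    X = ∑ r, outer (a r) (b r) (c r)}

/-- The multilinear rank: the dimensions of the spans of the mode-1, mode-2 and mode-3 vectors. -/
noncomputable def multilinearRank {d₁ d₂ d₃ : ℕ} (X : Tensor3 d₁ d₂ d₃) : ℕ × ℕ × ℕ :=
  (Module.finrank ℝ (Submodule.span ℝ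
      (Set.range fun (p : Fin d₂ × Fin d₃) (i : Fin d₁) => X i p.1 p.2)),
   Module.finrank ℝ (Submodule.span ℝ
      (Set.range fun (p : Fin d₁ × Fin d₃) (j : Fin d₂) => X p.1 j p.2)),
   Module.finrank ℝ (Submodule.span ℝ
      (Set.range fun (p : Fin d₁ × Fin d₂) (k : Fin d₃) => X p.1 p.2 k)))

/-- The multilinear transformation `(S, T, U) · X`. -/
def transform {d₁ d₂ d₃ : ℕ} (S : Matrix (Fin d₁) (Fin d₁) ℝ) (T : Matrix (Fin d₂) (Fin d₂) ℝ)
    (U : Matrix (Fin d₃) (Fin d₃) ℝ) (X : Tensor3 d₁ d₂ d₃) : Tensor3 d₁ d₂ d₃ :=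
  fun i j k => ∑ p, ∑ q, ∑ r, S i p * T j q * U k r * X p q r

/-- The orbit of `X` under invertible multilinear transformations. -/
def orbit {d₁ d₂ d₃ : ℕ} (X : Tensor3 d₁ d₂ d₃) : Set (Tensor3 d₁ d₂ d₃) :=
  {Z | ∃ (S : GL (Fin d₁) ℝ) (T : GL (Fin d₂) ℝ) (U : GL (Fin d₃) ℝ),
    Z = transform S.val T.val U.val X}

/-- The `k`-th frontal slab `(X i j k)ᵢⱼ`. -/
def slab {d₁ d₂ d₃ : ℕ} (X : Tensor3 d₁ d₂ d₃) (k : Fin d₃) : Matrix (Fin d₁) (Fin d₂) ℝ :=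
  Matrix.of fun i j => X i j k

/-- The `2 × 2 × 2` tensor `[A | B]` with frontal slabs `A` and `B`. -/
def ofSlabs (A B : Matrix (Fin 2) (Fin 2) ℝ) : Tensor3 2 2 2 :=
  fun i j k => (![A, B] k) i j

/-- The hyperdeterminant of a `2 × 2 × 2` tensor: the discriminant of the quadratic form
`det (s • X₁ + t • X₂)` in `(s, t)`, where `X₁`, `X₂` are the frontal slabs. -/
noncomputable def hyperdet (X : Tensor3 2 2 2) : ℝ :=
  (((slab X 0 + slab X 1).det - (slab X 0 - slab X 1).det) / 2) ^ 2
    - 4 * (slab X 0).det * (slab X 1).det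

/-- The canonical form of the orbit `G₂`. -/
def canonG2 : Tensor3 2 2 2 := ofSlabs !![1, 0; 0, 0] !![0, 0; 0, 1]

/-- The canonical form of the orbit `D₃`. -/
def canonD3 : Tensor3 2 2 2 := ofSlabs !![0, 1; 1, 0] !![1, 0; 0, 0]

/-- The canonical form of the orbit `G₃`. -/
def canonG3 : Tensor3 2 2 2 := ofSlabs !![-1, 0; 0, 1] !![0, 1; 1, 0]

end Tensor3

/-!
The proof rests on the first-order conditions. If `Y = x ⊗ y ⊗ z` is a nonzero best rank-one
approximation of `X`, then `X - Y` is orthogonal to `u ⊗ y ⊗ z`, `x ⊗ u ⊗ z` and `x ⊗ y ⊗ u` for all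
`u`. In orthonormal bases starting with the normalized factors, `Y` is `s • (e₀ ⊗ e₀ ⊗ e₀)` and only
four entries of `X - Y` survive: `a`, `b`, `c` at the places with a single index `0`, and `d` at
`(1, 1, 1)` (`IsBestRankOneApprox.exists_core`). If `a`, `b`, `c` are nonzero, such a tensor lies in
the orbit `D₃` (`transform_core_mem_orbit_canonD3`). Three rotation angles together with
`s, a, b, c, d` are eight parameters, as many as `X` has entries, so the tensors `X` that have such a
representation with `a = 0`, `b = 0` or `c = 0` lie in smooth images of hyperplanes, which are null
sets (`ae_forall_rotatedCore_eq`).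

The values of the invariants on the orbits come from the identity
`Δ (a ⊗ b ⊗ c + a' ⊗ b' ⊗ c') = (det (a, a') * det (b, b') * det (c, c')) ^ 2`. It shows that a
negative hyperdeterminant forces rank at least three, and that in a hypothetical decomposition of the
canonical form of `D₃` into two outer products some pair of factors is dependent, which the minors of
that form exclude. A tensor of rank at least three has multilinear rank `(2, 2, 2)`, since otherwise
it is an outer product of a vector with a `2 × 2` matrix.

The hyperdeterminant and the determinant of the first slab are nonzero almost everywhere, as both
are nonzero polynomials on the lines in suitable directions. By the sign of the discriminant `Δ`,
the pencil spanned by the slabs then has two distinct real roots and `X` lies in `G₂`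
(`mem_orbit_canonG2`), or a pair of conjugate complex roots and `X` lies in `G₃`
(`mem_orbit_canonG3`).
-/

namespace Tensor3

/-! ### Multilinear transformations and orbits -/

theorem transform_one {d₁ d₂ d₃ : ℕ} (X : Tensor3 d₁ d₂ d₃) : transform 1 1 1 X = X := by
  ext i j k
  simp [transform, Matrix.one_apply]

theorem transform_transform (S S' T T' U U' : Matrix (Fin 2) (Fin 2) ℝ) (X : Tensor3 2 2 2) :
    transform S T U (transform S' T' U' X) = transform (S * S') (T * T') (U * U') X := by
  ext i j k
  simp only [transform, Matrix.mul_apply, Fin.sum_univ_two]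
  ring

theorem transform_mem_orbit {d₁ d₂ d₃ : ℕ} {X : Tensor3 d₁ d₂ d₃}
    {S : Matrix (Fin d₁) (Fin d₁) ℝ} {T : Matrix (Fin d₂) (Fin d₂) ℝ}
    {U : Matrix (Fin d₃) (Fin d₃) ℝ} (hS : S.det ≠ 0) (hT : T.det ≠ 0) (hU : U.det ≠ 0) :
    transform S T U X ∈ orbit X :=
  ⟨.mkOfDetNeZero S hS, .mkOfDetNeZero T hT, .mkOfDetNeZero U hU, rfl⟩

theorem mem_orbit_symm {X Z : Tensor3 2 2 2} (h : Z ∈ orbit X) : X ∈ orbit Z := by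
  obtain ⟨S, T, U, rfl⟩ := h
  refine ⟨S⁻¹, T⁻¹, U⁻¹, ?_⟩
  rw [transform_transform, ← Units.val_mul, ← Units.val_mul, ← Units.val_mul, inv_mul_cancel,
    inv_mul_cancel, inv_mul_cancel]
  exact (transform_one X).symm

theorem transform_outer {d₁ d₂ d₃ : ℕ} (S : Matrix (Fin d₁) (Fin d₁) ℝ)
    (T : Matrix (Fin d₂) (Fin d₂) ℝ) (U : Matrix (Fin d₃) (Fin d₃) ℝ)
    (x : Fin d₁ → ℝ) (y : Fin d₂ → ℝ) (z : Fin d₃ → ℝ) :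
    transform S T U (outer x y z) = outer (S.mulVec x) (T.mulVec y) (U.mulVec z) := by
  ext i j k
  simp only [transform, outer, Matrix.mulVec, dotProduct, Finset.sum_mul_sum]
  refine Finset.sum_congr rfl fun p _ => ?_
  simp only [Finset.sum_mul]
  rw [Finset.sum_comm]
  exact Finset.sum_congr rfl fun r _ => Finset.sum_congr rfl fun q _ => by ring

theorem transform_sum {d₁ d₂ d₃ R : ℕ} (S : Matrix (Fin d₁) (Fin d₁) ℝ)
    (T : Matrix (Fin d₂) (Fin d₂) ℝ) (U : Matrix (Fin d₃) (Fin d₃) ℝ)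
    (X : Fin R → Tensor3 d₁ d₂ d₃) :
    transform S T U (∑ r, X r) = ∑ r, transform S T U (X r) := by
  let L : Tensor3 d₁ d₂ d₃ →+ Tensor3 d₁ d₂ d₃ :=
    { toFun := transform S T U
      map_zero' := by ext i j k; simp [transform]
      map_add' := fun X Y => by
        ext i j k; simp [transform, mul_add, Finset.sum_add_distrib] }
  exact map_sum L X Finset.univ

/-! ### Decompositions into outer products and the tensor rank -/

/-- `X` is a sum of `R` outer products; zero summands are allowed, so this means that the tensor
rank is at most `R`. -/
def IsSumOfOuter {d₁ d₂ d₃ : ℕ} (R : ℕ) (X : Tensor3 d₁ d₂ d₃) : Prop :=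
  ∃ (a : Fin R → Fin d₁ → ℝ) (b : Fin R → Fin d₂ → ℝ) (c : Fin R → Fin d₃ → ℝ),
    X = ∑ r, outer (a r) (b r) (c r)

theorem IsSumOfOuter.succ {d₁ d₂ d₃ R : ℕ} {X : Tensor3 d₁ d₂ d₃} (h : IsSumOfOuter R X) :
    IsSumOfOuter (R + 1) X := by
  obtain ⟨a, b, c, rfl⟩ := h
  refine ⟨Fin.cons 0 a, Fin.cons 0 b, Fin.cons 0 c, ?_⟩
  rw [Fin.sum_univ_succ]
  ext i j k
  simp [outer]

theorem IsSumOfOuter.mono {d₁ d₂ d₃ R R' : ℕ} {X : Tensor3 d₁ d₂ d₃} (h : IsSumOfOuter R X)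
    (hR : R ≤ R') : IsSumOfOuter R' X :=
  Nat.le_induction h (fun _ _ ih => ih.succ) R' hR

theorem IsSumOfOuter.transform {d₁ d₂ d₃ R : ℕ} {X : Tensor3 d₁ d₂ d₃} (h : IsSumOfOuter R X)
    (S : Matrix (Fin d₁) (Fin d₁) ℝ) (T : Matrix (Fin d₂) (Fin d₂) ℝ)
    (U : Matrix (Fin d₃) (Fin d₃) ℝ) : IsSumOfOuter R (transform S T U X) := by
  obtain ⟨a, b, c, rfl⟩ := h
  exact ⟨fun r => S.mulVec (a r), fun r => T.mulVec (b r), fun r => U.mulVec (c r), by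
    simp only [transform_sum, transform_outer]⟩

theorem IsSumOfOuter.of_mem_orbit {d₁ d₂ d₃ R : ℕ} {X Z : Tensor3 d₁ d₂ d₃}
    (h : IsSumOfOuter R X) (hZ : Z ∈ orbit X) : IsSumOfOuter R Z := by
  obtain ⟨S, T, U, rfl⟩ := hZ
  exact h.transform _ _ _

theorem rank_eq_succ {d₁ d₂ d₃ R : ℕ} {X : Tensor3 d₁ d₂ d₃} (h : IsSumOfOuter (R + 1) X)
    (h' : ¬ IsSumOfOuter R X) : rank X = R + 1 := by
  refine le_antisymm (Nat.sInf_le h) ?_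
  by_contra! hlt
  have hmem : IsSumOfOuter (rank X) X := Nat.sInf_mem (s := {R | IsSumOfOuter R X}) ⟨_, h⟩
  exact h' (hmem.mono (by omega))

theorem isSumOfOuter_canonG2 : IsSumOfOuter 2 canonG2 := by
  refine ⟨![![1, 0], ![0, 1]], ![![1, 0], ![0, 1]], ![![1, 0], ![0, 1]], ?_⟩
  ext i j k
  fin_cases i <;> fin_cases j <;> fin_cases k <;> simp [canonG2, ofSlabs, outer]

/-- With `e₀`, `e₁` the standard basis, `e₀ ⊗ e₁ + e₁ ⊗ e₀` is
`(e₀ + e₁) ⊗ (e₀ + e₁) - e₀ ⊗ e₀ - e₁ ⊗ e₁`, and the remaining part of the tensor is absorbed in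
the last two summands. -/
theorem isSumOfOuter_canonD3 : IsSumOfOuter 3 canonD3 := by
  refine ⟨![![1, 1], ![1, 0], ![0, 1]], ![![1, 1], ![1, 0], ![0, 1]],
    ![![1, 0], ![-1, 1], ![-1, 0]], ?_⟩
  ext i j k
  fin_cases i <;> fin_cases j <;> fin_cases k <;>
    simp [canonD3, ofSlabs, outer, Fin.sum_univ_three]

theorem isSumOfOuter_canonG3 : IsSumOfOuter 3 canonG3 := by
  refine ⟨![![1, 1], ![1, 0], ![0, 1]], ![![1, 1], ![1, 0], ![0, 1]],
    ![![0, 1], ![-1, -1], ![1, -1]], ?_⟩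
  ext i j k
  fin_cases i <;> fin_cases j <;> fin_cases k <;>
    simp [canonG3, ofSlabs, outer, Fin.sum_univ_three]

/-! ### The hyperdeterminant -/

theorem hyperdet_eq (X : Tensor3 2 2 2) :
    hyperdet X = (X 0 0 0 * X 1 1 1 + X 0 0 1 * X 1 1 0 - X 0 1 0 * X 1 0 1 - X 0 1 1 * X 1 0 0) ^ 2
      - 4 * (X 0 0 0 * X 1 1 0 - X 0 1 0 * X 1 0 0) * (X 0 0 1 * X 1 1 1 - X 0 1 1 * X 1 0 1) := by
  simp only [hyperdet, Matrix.det_fin_two, Matrix.add_apply, Matrix.sub_apply, slab,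
    Matrix.of_apply]
  ring

theorem hyperdet_outer_add_outer (a a' b b' c c' : Fin 2 → ℝ) :
    hyperdet (outer a b c + outer a' b' c') = ((a 0 * a' 1 - a 1 * a' 0) *
      (b 0 * b' 1 - b 1 * b' 0) * (c 0 * c' 1 - c 1 * c' 0)) ^ 2 := by
  simp only [hyperdet_eq, outer, Pi.add_apply]
  ring

theorem not_isSumOfOuter_one_of_hyperdet_ne_zero {X : Tensor3 2 2 2} (h : hyperdet X ≠ 0) :
    ¬ IsSumOfOuter 1 X := by
  rintro ⟨a, b, c, rfl⟩
  refine h ?_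
  simp only [Fin.sum_univ_one, hyperdet_eq, outer]
  ring

theorem not_isSumOfOuter_two_of_hyperdet_neg {X : Tensor3 2 2 2} (h : hyperdet X < 0) :
    ¬ IsSumOfOuter 2 X := by
  rintro ⟨a, b, c, rfl⟩
  rw [Fin.sum_univ_two, hyperdet_outer_add_outer] at h
  exact absurd h (not_lt.mpr (sq_nonneg _))

/-- The hyperdeterminant of `canonD3` vanishes, so in a decomposition into two outer products one of
the three pairs of vectors is linearly dependent. All minors of the unfolding in that mode then
vanish, although each unfolding of `canonD3` has a minor equal to `1`. -/
theorem not_isSumOfOuter_two_canonD3 : ¬ IsSumOfOuter 2 canonD3 := by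
  rintro ⟨a, b, c, h⟩
  have h0 : hyperdet canonD3 = 0 := by simp [hyperdet_eq, canonD3, ofSlabs]
  rw [h, Fin.sum_univ_two, hyperdet_outer_add_outer, sq_eq_zero_iff] at h0
  have e (i j k : Fin 2) : canonD3 i j k = a 0 i * b 0 j * c 0 k + a 1 i * b 1 j * c 1 k := by
    rw [h, Fin.sum_univ_two]; rfl
  have e000 := e 0 0 0
  have e100 := e 1 0 0
  have e010 := e 0 1 0
  have e001 := e 0 0 1
  have e110 := e 1 1 0
  have e101 := e 1 0 1
  simp only [canonD3, ofSlabs, Matrix.cons_val_zero, Matrix.cons_val_one, Matrix.of_apply,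
    Matrix.cons_val', Matrix.cons_val_fin_one] at e000 e100 e010 e001 e110 e101
  refine one_ne_zero (α := ℝ) ?_
  rcases mul_eq_zero.mp h0 with h0 | h0
  · rcases mul_eq_zero.mp h0 with h0 | h0
    · linear_combination e010 + (a 0 0 * b 0 1 * c 0 0 + a 1 0 * b 1 1 * c 1 0) * e100
        - (a 0 1 * b 0 1 * c 0 0 + a 1 1 * b 1 1 * c 1 0) * e000
        + (b 0 1 * c 0 0 * (b 1 0 * c 1 0) - b 1 1 * c 1 0 * (b 0 0 * c 0 0)) * h0
    · linear_combination e100 + (a 0 1 * b 0 0 * c 0 0 + a 1 1 * b 1 0 * c 1 0) * e010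
        - (a 0 1 * b 0 1 * c 0 0 + a 1 1 * b 1 1 * c 1 0) * e000
        + (a 0 1 * c 0 0 * (a 1 0 * c 1 0) - a 1 1 * c 1 0 * (a 0 0 * c 0 0)) * h0
  · linear_combination e100 + (a 0 1 * b 0 0 * c 0 0 + a 1 1 * b 1 0 * c 1 0) * e001
      - (a 0 1 * b 0 0 * c 0 1 + a 1 1 * b 1 0 * c 1 1) * e000
      + (a 0 1 * b 0 0 * (a 1 0 * b 1 0) - a 1 1 * b 1 0 * (a 0 0 * b 0 0)) * h0

theorem hyperdet_transform_left (S : Matrix (Fin 2) (Fin 2) ℝ) (X : Tensor3 2 2 2) :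
    hyperdet (transform S 1 1 X) = S.det ^ 2 * hyperdet X := by
  simp [hyperdet_eq, transform, Matrix.det_fin_two, Matrix.one_apply, Fin.sum_univ_two]
  ring

theorem hyperdet_transform_middle (T : Matrix (Fin 2) (Fin 2) ℝ) (X : Tensor3 2 2 2) :
    hyperdet (transform 1 T 1 X) = T.det ^ 2 * hyperdet X := by
  simp [hyperdet_eq, transform, Matrix.det_fin_two, Matrix.one_apply, Fin.sum_univ_two]
  ring

theorem hyperdet_transform_right (U : Matrix (Fin 2) (Fin 2) ℝ) (X : Tensor3 2 2 2) :
    hyperdet (transform 1 1 U X) = U.det ^ 2 * hyperdet X := by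
  simp [hyperdet_eq, transform, Matrix.det_fin_two, Matrix.one_apply, Fin.sum_univ_two]
  ring

theorem hyperdet_transform (S T U : Matrix (Fin 2) (Fin 2) ℝ) (X : Tensor3 2 2 2) :
    hyperdet (transform S T U X) = (S.det * T.det * U.det) ^ 2 * hyperdet X := by
  have h : transform S T U X = transform S 1 1 (transform 1 T 1 (transform 1 1 U X)) := by
    simp [transform_transform]
  rw [h, hyperdet_transform_left, hyperdet_transform_middle, hyperdet_transform_right]
  ring

/-! ### Multilinear rank of tensors of rank three -/

/-- A family of vectors in `ℝ²` that no nonzero linear form annihilates spans the plane. -/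
theorem finrank_span_range_eq_two {ι : Type*} {v : ι → Fin 2 → ℝ}
    (h : ∀ w₀ w₁ : ℝ, (∀ p, w₀ * v p 0 + w₁ * v p 1 = 0) → w₀ = 0 ∧ w₁ = 0) :
    Module.finrank ℝ (Submodule.span ℝ (Set.range v)) = 2 := by
  have htop : Submodule.span ℝ (Set.range v) = ⊤ := by
    by_contra hne
    obtain ⟨f, hf, hle⟩ := Submodule.exists_le_ker_of_lt_top _ (lt_top_iff_ne_top.mpr hne)
    have hfx (x : Fin 2 → ℝ) : f x = f (Pi.single 0 1) * x 0 + f (Pi.single 1 1) * x 1 := by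
      have hx : x = x 0 • Pi.single 0 1 + x 1 • Pi.single 1 1 := by
        ext i
        fin_cases i <;> simp
      conv_lhs => rw [hx, map_add, map_smul, map_smul]
      rw [smul_eq_mul, smul_eq_mul, mul_comm, mul_comm (x 1)]
    obtain ⟨h0, h1⟩ := h _ _ fun p => (hfx (v p)).symm.trans
      (hle (Submodule.subset_span ⟨p, rfl⟩))
    exact hf (LinearMap.ext fun x => by rw [hfx, h0, h1]; simp)
  rw [htop, finrank_top, Module.finrank_fin_fun]

/-- If `w ≠ 0` annihilates two numbers `x₀`, `x₁`, then `(x₀, x₁)` is a multiple of the vector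
orthogonal to `w`. -/
theorem eq_mul_of_annihilated {w₀ w₁ x₀ x₁ : ℝ} (hw : ¬ (w₀ = 0 ∧ w₁ = 0))
    (h : w₀ * x₀ + w₁ * x₁ = 0) :
    x₀ = -w₁ / (w₀ ^ 2 + w₁ ^ 2) * (w₀ * x₁ - w₁ * x₀) ∧
      x₁ = w₀ / (w₀ ^ 2 + w₁ ^ 2) * (w₀ * x₁ - w₁ * x₀) := by
  have h0 : w₀ ^ 2 + w₁ ^ 2 ≠ 0 := fun h0 => hw ⟨by nlinarith, by nlinarith⟩
  constructor
  · field_simp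
    linear_combination w₀ * h
  · field_simp
    linear_combination w₁ * h

/-- If the vectors of one mode do not span the plane, the tensor is an outer product of a vector with
a `2 × 2` matrix, hence a sum of two outer products. -/
theorem multilinearRank_eq_of_not_isSumOfOuter_two {X : Tensor3 2 2 2} (h : ¬ IsSumOfOuter 2 X) :
    multilinearRank X = (2, 2, 2) := by
  simp only [multilinearRank, Prod.mk.injEq]
  refine ⟨finrank_span_range_eq_two fun w₀ w₁ hw => ?_,
    finrank_span_range_eq_two fun w₀ w₁ hw => ?_, finrank_span_range_eq_two fun w₀ w₁ hw => ?_⟩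
  · by_contra hne
    refine h ⟨fun _ => ![-w₁ / (w₀ ^ 2 + w₁ ^ 2), w₀ / (w₀ ^ 2 + w₁ ^ 2)], fun r => Pi.single r 1,
      fun r k => w₀ * X 1 r k - w₁ * X 0 r k, ?_⟩
    ext i j k
    obtain ⟨e0, e1⟩ := eq_mul_of_annihilated hne (hw (j, k))
    fin_cases i <;> fin_cases j <;> simpa [outer] using by assumption
  · by_contra hne
    refine h ⟨fun r => Pi.single r 1, fun _ => ![-w₁ / (w₀ ^ 2 + w₁ ^ 2), w₀ / (w₀ ^ 2 + w₁ ^ 2)],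
      fun r k => w₀ * X r 1 k - w₁ * X r 0 k, ?_⟩
    ext i j k
    obtain ⟨e0, e1⟩ := eq_mul_of_annihilated hne (hw (i, k))
    fin_cases i <;> fin_cases j <;> simpa [outer] using by assumption
  · by_contra hne
    refine h ⟨fun r => Pi.single r 1, fun r j => w₀ * X r j 1 - w₁ * X r j 0,
      fun _ => ![-w₁ / (w₀ ^ 2 + w₁ ^ 2), w₀ / (w₀ ^ 2 + w₁ ^ 2)], ?_⟩
    ext i j k
    obtain ⟨e0, e1⟩ := eq_mul_of_annihilated hne (hw (i, j))
    fin_cases i <;> fin_cases k <;> simpa [outer, mul_comm] using by assumption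

/-! ### The three orbits -/

theorem invariants_of_mem_orbit_canonD3 {X : Tensor3 2 2 2} (h : X ∈ orbit canonD3) :
    hyperdet X = 0 ∧ multilinearRank X = (2, 2, 2) ∧ rank X = 3 := by
  have h2 : ¬ IsSumOfOuter 2 X := fun hX =>
    not_isSumOfOuter_two_canonD3 (hX.of_mem_orbit (mem_orbit_symm h))
  refine ⟨?_, multilinearRank_eq_of_not_isSumOfOuter_two h2,
    rank_eq_succ (isSumOfOuter_canonD3.of_mem_orbit h) h2⟩
  obtain ⟨S, T, U, rfl⟩ := h
  rw [hyperdet_transform]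
  simp [hyperdet_eq, canonD3, ofSlabs]

theorem exists_eq_outer_of_det_eq_zero {M : Matrix (Fin 2) (Fin 2) ℝ} (h : M.det = 0) :
    ∃ u v : Fin 2 → ℝ, ∀ i j, M i j = u i * v j := by
  rw [Matrix.det_fin_two] at h
  by_cases h0 : M 0 0 = 0
  · rcases mul_eq_zero.mp (by linarith [h, h0, mul_eq_zero_of_left h0 (M 1 1)] :
      M 0 1 * M 1 0 = 0) with h1 | h1
    · refine ⟨![0, 1], ![M 1 0, M 1 1], fun i j => ?_⟩
      fin_cases i <;> fin_cases j <;> simp [h0, h1]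
    · refine ⟨![M 0 1, M 1 1], ![0, 1], fun i j => ?_⟩
      fin_cases i <;> fin_cases j <;> simp [h0, h1]
  · refine ⟨![1, M 1 0 / M 0 0], ![M 0 0, M 0 1], fun i j => ?_⟩
    fin_cases i <;> fin_cases j <;> simp [h0]
    field_simp
    linarith

/-- Let `A`, `B` be the frontal slabs. The polynomial `det (B - l A)` in `l` has two distinct real
roots; at each of them `B - l A` is an outer product, and `A`, `B` are linear combinations of these
two outer products. -/
theorem mem_orbit_canonG2 {X : Tensor3 2 2 2} (hA : (slab X 0).det ≠ 0) (hX : 0 < hyperdet X) :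
    X ∈ orbit canonG2 := by
  obtain ⟨l, m, hlm, hl, hm⟩ : ∃ l m : ℝ, l ≠ m ∧ (slab X 1 - l • slab X 0).det = 0 ∧
      (slab X 1 - m • slab X 0).det = 0 := by
    have hs := Real.sq_sqrt hX.le
    have hs0 := (Real.sqrt_pos.mpr hX).ne'
    set s := √(hyperdet X)
    rw [hyperdet_eq] at hs
    set b := X 0 0 0 * X 1 1 1 + X 0 0 1 * X 1 1 0 - X 0 1 0 * X 1 0 1 - X 0 1 1 * X 1 0 0 with hb
    have hroot (t : ℝ) (ht : (2 * (slab X 0).det * t - b) ^ 2 = s ^ 2) :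
        (slab X 1 - t • slab X 0).det = 0 := by
      refine (mul_eq_zero.mp (?_ : 4 * (slab X 0).det * _ = 0)).resolve_left (by simpa using hA)
      simp only [Matrix.det_fin_two, Matrix.sub_apply, Matrix.smul_apply, slab, Matrix.of_apply,
        smul_eq_mul] at ht ⊢
      rw [hb] at ht hs
      linear_combination ht + hs
    refine ⟨(b + s) / (2 * (slab X 0).det), (b - s) / (2 * (slab X 0).det), fun h => hs0 ?_,
      hroot _ ?_, hroot _ ?_⟩
    · field_simp at h
      linarith
    · field_simp
      ring
    · field_simp
      ring
  obtain ⟨u, v, huv⟩ := exists_eq_outer_of_det_eq_zero hl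
  obtain ⟨u', v', huv'⟩ := exists_eq_outer_of_det_eq_zero hm
  simp only [slab, Matrix.sub_apply, Matrix.smul_apply, Matrix.of_apply, smul_eq_mul] at huv huv'
  have hml : m - l ≠ 0 := sub_ne_zero.mpr hlm.symm
  have e0 (i j : Fin 2) : X i j 0 = (m - l)⁻¹ * (u i * v j - u' i * v' j) := by
    rw [← huv, ← huv']
    field_simp
    ring
  have e1 (i j : Fin 2) : X i j 1 = (m - l)⁻¹ * (m * (u i * v j) - l * (u' i * v' j)) := by
    rw [← huv, ← huv']
    field_simp
    ring
  -- So the vectors in each of the first two modes are independent.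
  have hdet : (slab X 0).det = -((m - l)⁻¹ ^ 2 * ((u 0 * u' 1 - u' 0 * u 1) *
      (v 0 * v' 1 - v' 0 * v 1))) := by
    simp only [Matrix.det_fin_two, slab, Matrix.of_apply, e0]
    ring
  have hX : X = transform !![u 0, u' 0; u 1, u' 1] !![v 0, v' 0; v 1, v' 1]
      !![(m - l)⁻¹, -(m - l)⁻¹; (m - l)⁻¹ * m, -((m - l)⁻¹ * l)] canonG2 := by
    ext i j k
    fin_cases k
    · rw [show X i j ⟨0, by norm_num⟩ = X i j 0 from rfl, e0]
      fin_cases i <;> fin_cases j <;>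
        simp [transform, canonG2, ofSlabs, Fin.sum_univ_two] <;> ring
    · rw [show X i j ⟨1, by norm_num⟩ = X i j 1 from rfl, e1]
      fin_cases i <;> fin_cases j <;>
        simp [transform, canonG2, ofSlabs, Fin.sum_univ_two] <;> ring
  rw [hX]
  rw [hdet] at hA
  refine transform_mem_orbit ?_ ?_ ?_
  · rw [Matrix.det_fin_two_of]
    intro h
    exact hA (by rw [h]; ring)
  · rw [Matrix.det_fin_two_of]
    intro h
    exact hA (by rw [h]; ring)
  · rw [Matrix.det_fin_two_of]
    have : (m - l)⁻¹ * -((m - l)⁻¹ * l) - -(m - l)⁻¹ * ((m - l)⁻¹ * m) = (m - l)⁻¹ := by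
      field_simp
      ring
    rw [this]
    exact inv_ne_zero hml

/-- Let `A`, `B` be the frontal slabs. As `det (s A + t B)` has no real zero other than
`s = t = 0`, there is a matrix `C` such that `B = p A + q C` and
`det (s A + t C) = det A * (s ^ 2 + t ^ 2)`. The matrix `N = A⁻¹ C` satisfies `N ^ 2 = -1`, and in
the basis `e₀`, `N e₀` of `ℝ²` it is the rotation by a right angle. -/
theorem mem_orbit_canonG3 {X : Tensor3 2 2 2} (hX : hyperdet X < 0) : X ∈ orbit canonG3 := by
  obtain ⟨α, hα⟩ : ∃ α, α = X 0 0 0 * X 1 1 0 - X 0 1 0 * X 1 0 0 := ⟨_, rfl⟩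
  have hα0 : α ≠ 0 := by
    intro h
    rw [hyperdet_eq, ← hα, h] at hX
    nlinarith [sq_nonneg (X 0 0 0 * X 1 1 1 + X 0 0 1 * X 1 1 0 - X 0 1 0 * X 1 0 1
      - X 0 1 1 * X 1 0 0)]
  -- `p ± i q` are the roots of `det (B - l A)`.
  obtain ⟨p, q, C, hq, hC, hdet, hmix⟩ : ∃ (p q : ℝ) (C : Fin 2 → Fin 2 → ℝ), q ≠ 0 ∧
      (∀ i j, X i j 1 = p * X i j 0 + q * C i j) ∧ C 0 0 * C 1 1 - C 0 1 * C 1 0 = α ∧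
      X 0 0 0 * C 1 1 + X 1 1 0 * C 0 0 - X 0 1 0 * C 1 0 - X 1 0 0 * C 0 1 = 0 := by
    have hs := Real.sq_sqrt (neg_pos.mpr hX).le
    have hs0 := (Real.sqrt_pos.mpr (neg_pos.mpr hX)).ne'
    set s := √(-hyperdet X)
    rw [hyperdet_eq, ← hα] at hs
    obtain ⟨b, hb⟩ : ∃ b, b = X 0 0 0 * X 1 1 1 + X 0 0 1 * X 1 1 0 - X 0 1 0 * X 1 0 1
      - X 0 1 1 * X 1 0 0 := ⟨_, rfl⟩
    rw [← hb] at hs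
    refine ⟨b / (2 * α), s / (2 * α), fun i j => (2 * α * X i j 1 - b * X i j 0) / s,
      div_ne_zero hs0 (mul_ne_zero two_ne_zero hα0), fun i j => ?_, ?_, ?_⟩
    · field_simp
      ring
    · field_simp
      linear_combination (-2 * α * b) * (-hb) - α * hs - b ^ 2 * hα
    · field_simp
      linear_combination (-2 * α) * hb + 2 * b * hα
  -- If the first columns of `A` and `C` were dependent, a nonzero `s A + t C` would be singular.
  have hρ : X 0 0 0 * C 1 0 - X 1 0 0 * C 0 0 ≠ 0 := by
    intro hρ
    have h0 : X 0 0 0 ^ 2 + C 0 0 ^ 2 = 0 := by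
      refine (mul_eq_zero.mp (?_ : α * _ = 0)).resolve_left hα0
      linear_combination (-X 0 0 0 ^ 2) * hdet + C 0 0 ^ 2 * hα + X 0 0 0 * C 0 0 * hmix
        + (X 0 1 0 * C 0 0 - X 0 0 0 * C 0 1) * hρ
    have h1 : X 1 0 0 ^ 2 + C 1 0 ^ 2 = 0 := by
      refine (mul_eq_zero.mp (?_ : α * _ = 0)).resolve_left hα0
      linear_combination (-X 1 0 0 ^ 2) * hdet + C 1 0 ^ 2 * hα + X 1 0 0 * C 1 0 * hmix
        + (X 1 1 0 * C 1 0 - X 1 0 0 * C 1 1) * hρ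
    have h0' : X 0 0 0 = 0 := by nlinarith [sq_nonneg (C 0 0)]
    have h1' : X 1 0 0 = 0 := by nlinarith [sq_nonneg (C 1 0)]
    exact hα0 (by rw [hα, h0', h1']; ring)
  obtain ⟨ρ, hρe⟩ : ∃ ρ, ρ = X 0 0 0 * C 1 0 - X 1 0 0 * C 0 0 := ⟨_, rfl⟩
  rw [← hρe] at hρ
  obtain ⟨x, hx⟩ : ∃ x, ρ * x = X 0 1 0 * C 1 0 - X 1 1 0 * C 0 0 := ⟨_, mul_div_cancel₀ _ hρ⟩
  obtain ⟨y, hy⟩ : ∃ y, ρ * y = α := ⟨_, mul_div_cancel₀ _ hρ⟩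
  have eA (i : Fin 2) : X i 1 0 = x * X i 0 0 + y * C i 0 := by
    refine mul_left_cancel₀ hρ ?_
    fin_cases i
    · simp only [Fin.zero_eta]
      linear_combination (-X 0 0 0) * hx - C 0 0 * hy - C 0 0 * hα + X 0 1 0 * hρe
    · simp only [Fin.mk_one]
      linear_combination (-X 1 0 0) * hx - C 1 0 * hy - C 1 0 * hα + X 1 1 0 * hρe
  have eC (i : Fin 2) : C i 1 = x * C i 0 - y * X i 0 0 := by
    refine mul_left_cancel₀ hρ ?_
    fin_cases i
    · simp only [Fin.zero_eta]
      linear_combination (-C 0 0) * hx + X 0 0 0 * hy - X 0 0 0 * hdet + C 0 0 * hmix + C 0 1 * hρe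
    · simp only [Fin.mk_one]
      linear_combination (-C 1 0) * hx + X 1 0 0 * hy - X 1 0 0 * hdet + C 1 0 * hmix + C 1 1 * hρe
  have hX' : X = transform !![-X 0 0 0, C 0 0; -X 1 0 0, C 1 0] !![1, 0; x, y]
      !![1, 0; p, q] canonG3 := by
    ext i j k
    fin_cases k
    · fin_cases i <;> fin_cases j <;>
        simp [transform, canonG3, ofSlabs, Fin.sum_univ_two, eA 0, eA 1] <;> ring
    · rw [show X i j ⟨1, by norm_num⟩ = X i j 1 from rfl, hC]
      fin_cases i <;> fin_cases j <;>
        simp [transform, canonG3, ofSlabs, Fin.sum_univ_two, eA 0, eA 1, eC 0, eC 1] <;> ring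
  rw [hX']
  refine transform_mem_orbit ?_ ?_ ?_
  · rw [Matrix.det_fin_two_of]
    intro h
    exact hρ (by rw [hρe]; linarith)
  · rw [Matrix.det_fin_two_of]
    intro h
    exact hα0 (by rw [← hy, show y = 0 by linarith, mul_zero])
  · rw [Matrix.det_fin_two_of]
    simpa using hq

/-! ### Generic tensors -/

/-- If a continuous function restricts to a nonzero polynomial on each line of a fixed direction, then
its zero set meets these lines in finite sets and hence is null. -/
theorem ae_ne_zero_of_polynomial_on_lines {E : Type*} [NormedAddCommGroup E] [NormedSpace ℝ E]
    [MeasurableSpace E] [BorelSpace E] [FiniteDimensional ℝ E] (μ : Measure E)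
    [μ.IsAddHaarMeasure] {f : E → ℝ} (hf : Continuous f) (v : E)
    (h : ∀ x, ∃ p : Polynomial ℝ, p ≠ 0 ∧ ∀ t : ℝ, f (x + t • v) = p.eval t) :
    ∀ᵐ x ∂μ, f x ≠ 0 := by
  have : LocallyCompactSpace E := by
    have := FiniteDimensional.proper ℝ E
    infer_instance
  refine ae_mem_of_ae_add_linearMap_mem (s := {x | f x ≠ 0}) (LinearMap.toSpanSingleton ℝ E v)
    volume μ (isOpen_ne_fun hf continuous_const).measurableSet fun x => ?_
  obtain ⟨p, hp, hfp⟩ := h x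
  refine measure_mono_null (fun t ht => ?_) (p.roots.toFinset.finite_toSet.measure_zero volume)
  simp only [Set.mem_compl_iff, Set.mem_ofPred_eq, not_not, LinearMap.toSpanSingleton_apply,
    hfp] at ht
  simpa [hp] using ht

/-- Instance search does not see that `volume` on the iterated product is a product measure. -/
instance isAddHaarMeasure_volume (d₁ d₂ d₃ : ℕ) :
    (volume : Measure (Tensor3 d₁ d₂ d₃)).IsAddHaarMeasure :=
  have : (volume : Measure (Fin d₂ → Fin d₃ → ℝ)).IsAddHaarMeasure :=
    Measure.pi.isAddHaarMeasure fun _ => volume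
  Measure.pi.isAddHaarMeasure fun _ => volume

open Polynomial in
theorem ae_det_slab_ne_zero : ∀ᵐ Z : Tensor3 2 2 2 ∂volume, (slab Z 0).det ≠ 0 := by
  refine ae_ne_zero_of_polynomial_on_lines volume ?_ (ofSlabs 1 0) fun Z => ?_
  · simp only [Matrix.det_fin_two, slab, Matrix.of_apply]
    fun_prop
  · refine ⟨(C (Z 0 0 0) + X) * (C (Z 1 1 0) + X) - C (Z 0 1 0 * Z 1 0 0), fun h => ?_, fun t => ?_⟩
    · have h2 := congrArg (coeff · 2) h
      ring_nf at h2
      simp [coeff_X, coeff_C] at h2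
    · simp [Matrix.det_fin_two, slab, ofSlabs]

open Polynomial in
theorem ae_hyperdet_ne_zero : ∀ᵐ Z : Tensor3 2 2 2 ∂volume, hyperdet Z ≠ 0 := by
  refine ae_ne_zero_of_polynomial_on_lines volume ?_ canonG2 fun Z => ?_
  · rw [show hyperdet = _ from funext hyperdet_eq]
    fun_prop
  · refine ⟨((C (Z 0 0 0) + X) * (C (Z 1 1 1) + X)
        + C (Z 0 0 1 * Z 1 1 0 - Z 0 1 0 * Z 1 0 1 - Z 0 1 1 * Z 1 0 0)) ^ 2
      - C 4 * ((C (Z 0 0 0) + X) * C (Z 1 1 0) - C (Z 0 1 0 * Z 1 0 0)) *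
        (C (Z 0 0 1) * (C (Z 1 1 1) + X) - C (Z 0 1 1 * Z 1 0 1)), Monic.ne_zero ?_, fun t => ?_⟩
    · monicity!
    · simp [hyperdet_eq, canonG2, ofSlabs]
      ring

/-! ### First-order conditions for a best rank-one approximation -/

/-- The scalar product whose norm is the Frobenius norm. -/
def frobInner {d₁ d₂ d₃ : ℕ} (X Y : Tensor3 d₁ d₂ d₃) : ℝ :=
  ∑ i, ∑ j, ∑ k, X i j k * Y i j k

theorem frobSq_sub_smul {d₁ d₂ d₃ : ℕ} (W V : Tensor3 d₁ d₂ d₃) (t : ℝ) :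
    frobSq (W - t • V) = frobSq W - 2 * t * frobInner W V + t ^ 2 * frobSq V := by
  simp only [frobSq, frobInner, Finset.mul_sum, ← Finset.sum_sub_distrib, ← Finset.sum_add_distrib]
  refine Finset.sum_congr rfl fun i _ => Finset.sum_congr rfl fun j _ =>
    Finset.sum_congr rfl fun k _ => ?_
  simp only [Pi.sub_apply, Pi.smul_apply, smul_eq_mul]
  ring

theorem frobInner_eq_zero_of_le {d₁ d₂ d₃ : ℕ} {W V : Tensor3 d₁ d₂ d₃}
    (h : ∀ t : ℝ, frobSq W ≤ frobSq (W - t • V)) : frobInner W V = 0 := by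
  have hV : 0 ≤ frobSq V := Finset.sum_nonneg fun i _ => Finset.sum_nonneg fun j _ =>
    Finset.sum_nonneg fun k _ => sq_nonneg _
  -- The shift by `1` replaces the optimal step `⟪W, V⟫ / ‖V‖ ^ 2`, which is junk for `V = 0`.
  have h1 := h (frobInner W V / (frobSq V + 1))
  rw [frobSq_sub_smul] at h1
  have e : frobSq W - 2 * (frobInner W V / (frobSq V + 1)) * frobInner W V +
      (frobInner W V / (frobSq V + 1)) ^ 2 * frobSq V =
      frobSq W - (frobInner W V / (frobSq V + 1)) ^ 2 * (frobSq V + 2) := by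
    field_simp
    ring
  rw [e] at h1
  have h2 : (frobInner W V / (frobSq V + 1)) ^ 2 * (frobSq V + 2) = 0 :=
    le_antisymm (by linarith) (by positivity)
  have h3 : frobInner W V / (frobSq V + 1) = 0 :=
    sq_eq_zero_iff.mp ((mul_eq_zero.mp h2).resolve_right (by positivity))
  exact (div_eq_zero_iff.mp h3).resolve_right (by positivity)

/-- The residual of a best rank-one approximation `x ⊗ y ⊗ z` is orthogonal to every outer product
that shares two of the three factors with it. -/
theorem IsBestRankOneApprox.frobInner_eq_zero {d₁ d₂ d₃ : ℕ} {X : Tensor3 d₁ d₂ d₃}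
    {x : Fin d₁ → ℝ} {y : Fin d₂ → ℝ} {z : Fin d₃ → ℝ}
    (h : IsBestRankOneApprox X (outer x y z)) :
    (∀ u, frobInner (X - outer x y z) (outer u y z) = 0) ∧
      (∀ u, frobInner (X - outer x y z) (outer x u z) = 0) ∧
      ∀ u, frobInner (X - outer x y z) (outer x y u) = 0 := by
  refine ⟨fun u => frobInner_eq_zero_of_le fun t => (h.2 (x + t • u) y z).trans_eq ?_,
    fun u => frobInner_eq_zero_of_le fun t => (h.2 x (y + t • u) z).trans_eq ?_,
    fun u => frobInner_eq_zero_of_le fun t => (h.2 x y (z + t • u)).trans_eq ?_⟩ <;>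
  · congr 1
    ext i j k
    simp only [outer, Pi.sub_apply, Pi.add_apply, Pi.smul_apply, smul_eq_mul]
    ring

theorem IsBestRankOneApprox.eq_zero_of_zero {d₁ d₂ d₃ : ℕ} {X : Tensor3 d₁ d₂ d₃}
    (h : IsBestRankOneApprox X 0) : X = 0 := by
  ext i j k
  have h0 : frobInner X (outer (Pi.single i 1) (Pi.single j 1) (Pi.single k 1)) = 0 := by
    refine frobInner_eq_zero_of_le fun t => ?_
    have := h.2 (t • Pi.single i 1) (Pi.single j 1) (Pi.single k 1)
    rw [sub_zero] at this
    refine this.trans_eq ?_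
    congr 1
    ext i' j' k'
    simp only [outer, Pi.sub_apply, Pi.smul_apply, smul_eq_mul]
    ring
  simpa [frobInner, outer, Pi.single_apply] using h0

/-! ### Tensors whose residual is degenerate -/

/-- The rotation of the plane by the angle `θ`. -/
noncomputable def rotation (θ : ℝ) : Matrix (Fin 2) (Fin 2) ℝ :=
  !![Real.cos θ, -Real.sin θ; Real.sin θ, Real.cos θ]

theorem rotation_mul_transpose (θ : ℝ) : rotation θ * (rotation θ).transpose = 1 := by
  ext i j
  have := Real.sin_sq_add_cos_sq θ
  fin_cases i <;> fin_cases j <;> simp [rotation, Matrix.mul_apply, Fin.sum_univ_two] <;> linarith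

theorem det_rotation_ne_zero (θ : ℝ) : (rotation θ).det ≠ 0 := by
  have := Real.sin_sq_add_cos_sq θ
  rw [rotation, Matrix.det_fin_two_of]
  nlinarith

theorem exists_eq_smul_rotation (x : Fin 2 → ℝ) :
    ∃ r θ : ℝ, ∀ i, x i = r * rotation θ i 0 := by
  let w : ℂ := ⟨x 0, x 1⟩
  refine ⟨‖w‖, w.arg, fun i => ?_⟩
  fin_cases i
  · simp [rotation, Complex.norm_mul_cos_arg, w]
  · simp [rotation, Complex.norm_mul_sin_arg, w]

/-- The tensor whose entries at `(0, 0, 1)`, `(0, 1, 0)`, `(1, 0, 0)` vanish, and whose other entries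
are the arguments in lexicographic order. -/
def core (s a b c d : ℝ) : Tensor3 2 2 2 :=
  ![![![s, 0], ![0, a]], ![![0, b], ![c, d]]]

/-- In coordinates rotated so that a best rank-one approximation `Y` is `s • (e₀ ⊗ e₀ ⊗ e₀)`, the
first-order conditions are the vanishing of the residual at `(0, 0, 0)`, `(0, 0, 1)`, `(0, 1, 0)` and
`(1, 0, 0)`. -/
theorem IsBestRankOneApprox.exists_core {X Y : Tensor3 2 2 2} (hX : X ≠ 0)
    (h : IsBestRankOneApprox X Y) : ∃ θ φ ψ s a b c d : ℝ,
      X = transform (rotation θ) (rotation φ) (rotation ψ) (core s a b c d) ∧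
      X - Y = transform (rotation θ) (rotation φ) (rotation ψ) (core 0 a b c d) := by
  obtain ⟨x, y, z, rfl⟩ := h.1
  obtain ⟨r₁, θ, hx⟩ := exists_eq_smul_rotation x
  obtain ⟨r₂, φ, hy⟩ := exists_eq_smul_rotation y
  obtain ⟨r₃, ψ, hz⟩ := exists_eq_smul_rotation z
  have hY : outer x y z ≠ 0 := fun hY => hX (IsBestRankOneApprox.eq_zero_of_zero (hY ▸ h))
  have hr : r₁ ≠ 0 ∧ r₂ ≠ 0 ∧ r₃ ≠ 0 := by
    refine ⟨?_, ?_, ?_⟩ <;>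
    · rintro rfl
      exact hY (by ext i j k; simp [outer, hx, hy, hz])
  obtain ⟨h₁, h₂, h₃⟩ := h.frobInner_eq_zero
  set W := X - outer x y z with hW
  -- `W'` is the residual in the rotated coordinates.
  obtain ⟨W', hW'⟩ : ∃ W', W' = transform (rotation θ).transpose (rotation φ).transpose
      (rotation ψ).transpose W := ⟨_, rfl⟩
  have hWW' : W = transform (rotation θ) (rotation φ) (rotation ψ) W' := by
    rw [hW', transform_transform, rotation_mul_transpose, rotation_mul_transpose,
      rotation_mul_transpose, transform_one]
  have g₁ (p : Fin 2) : W' p 0 0 = 0 := by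
    refine (mul_eq_zero.mp ((?_ : _ = _).trans (h₁ fun i => rotation θ i p))).resolve_left
      (mul_ne_zero hr.2.1 hr.2.2)
    simp only [hW', frobInner, transform, outer, hy, hz, Fin.sum_univ_two, Matrix.transpose_apply]
    ring
  have g₂ (p : Fin 2) : W' 0 p 0 = 0 := by
    refine (mul_eq_zero.mp ((?_ : _ = _).trans (h₂ fun i => rotation φ i p))).resolve_left
      (mul_ne_zero hr.1 hr.2.2)
    simp only [hW', frobInner, transform, outer, hx, hz, Fin.sum_univ_two, Matrix.transpose_apply]
    ring
  have g₃ (p : Fin 2) : W' 0 0 p = 0 := by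
    refine (mul_eq_zero.mp ((?_ : _ = _).trans (h₃ fun i => rotation ψ i p))).resolve_left
      (mul_ne_zero hr.1 hr.2.1)
    simp only [hW', frobInner, transform, outer, hx, hy, Fin.sum_univ_two, Matrix.transpose_apply]
    ring
  have hcore : W' = core 0 (W' 0 1 1) (W' 1 0 1) (W' 1 1 0) (W' 1 1 1) := by
    ext i j k
    fin_cases i <;> fin_cases j <;> fin_cases k <;> simp [core, g₁, g₂, g₃]
  rw [hcore] at hWW'
  refine ⟨θ, φ, ψ, r₁ * r₂ * r₃, _, _, _, _, ?_, hWW'⟩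
  have hXW : X = outer x y z + W := by rw [hW]; abel
  rw [hXW, hWW']
  ext i j k
  simp [outer, hx, hy, hz, transform, core, Fin.sum_univ_two]
  ring

theorem transform_core_mem_orbit_canonD3 (θ φ ψ : ℝ) {a b c : ℝ} (ha : a ≠ 0) (hb : b ≠ 0)
    (hc : c ≠ 0) (d : ℝ) :
    transform (rotation θ) (rotation φ) (rotation ψ) (core 0 a b c d) ∈ orbit canonD3 := by
  have h : core 0 a b c d =
      transform !![0, a; 1, 0] !![0, b; 1, 0] !![0, c; 1, d] canonD3 := by
    ext i j k
    fin_cases i <;> fin_cases j <;> fin_cases k <;>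
      simp [core, transform, canonD3, ofSlabs, Fin.sum_univ_two]
  rw [h, transform_transform]
  refine transform_mem_orbit ?_ ?_ ?_ <;>
    simp [Matrix.det_mul, det_rotation_ne_zero, ha, hb, hc]

/-- The tensors `transform (rotation θ) (rotation φ) (rotation ψ) (core s a b c d)`, with the eight
parameters collected in a tensor: the angles take the places of the zero entries of the core. -/
noncomputable def rotatedCore (p : Tensor3 2 2 2) : Tensor3 2 2 2 :=
  transform (rotation (p 0 0 1)) (rotation (p 0 1 0)) (rotation (p 1 0 0))
    (core (p 0 0 0) (p 0 1 1) (p 1 0 1) (p 1 1 0) (p 1 1 1))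

theorem differentiable_rotatedCore : Differentiable ℝ rotatedCore := by
  unfold rotatedCore transform
  refine differentiable_pi.mpr fun i => differentiable_pi.mpr fun j =>
    differentiable_pi.mpr fun k => ?_
  fin_cases i <;> fin_cases j <;> fin_cases k <;>
  · simp [rotation, core, Fin.sum_univ_two]
    fun_prop

/-- Fixing one of the eight parameters of `rotatedCore` to be `0` leaves the smooth image of a
hyperplane, a null set. -/
theorem ae_forall_rotatedCore_eq (i j k : Fin 2) :
    ∀ᵐ X : Tensor3 2 2 2 ∂volume, ∀ p, X = rotatedCore p → p i j k ≠ 0 := by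
  have hnull : volume {p : Tensor3 2 2 2 | p i j k = 0} = 0 := by
    let L : Tensor3 2 2 2 →ₗ[ℝ] ℝ := LinearMap.proj k ∘ₗ LinearMap.proj j ∘ₗ LinearMap.proj i
    refine Measure.addHaar_submodule volume (LinearMap.ker L) fun h => ?_
    have : L (fun _ _ _ => 1) = 0 := LinearMap.mem_ker.mp (h ▸ Submodule.mem_top)
    exact one_ne_zero this
  refine measure_mono_null (fun X hX => ?_)
    (addHaar_image_eq_zero_of_differentiableOn_of_addHaar_eq_zero volume
      differentiable_rotatedCore.differentiableOn hnull)
  simp only [Set.mem_compl_iff, Set.mem_ofPred_eq, not_forall, not_not] at hX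
  obtain ⟨p, hp, hp0⟩ := hX
  exact ⟨p, hp0, hp.symm⟩

end Tensor3

theorem theorem1 :
    ∀ᵐ X : Tensor3 2 2 2 ∂volume,
      ((X ∈ Tensor3.orbit Tensor3.canonG2 ∧ Tensor3.rank X = 2) ∨
        (X ∈ Tensor3.orbit Tensor3.canonG3 ∧ Tensor3.rank X = 3)) ∧
      ∀ Y : Tensor3 2 2 2, Tensor3.IsBestRankOneApprox X Y →
        X - Y ∈ Tensor3.orbit Tensor3.canonD3 ∧
        Tensor3.hyperdet (X - Y) = 0 ∧
        Tensor3.multilinearRank (X - Y) = (2, 2, 2) ∧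
        Tensor3.rank (X - Y) = 3 := by
  open Tensor3 in
  filter_upwards [ae_det_slab_ne_zero, ae_hyperdet_ne_zero, ae_forall_rotatedCore_eq 0 1 1,
    ae_forall_rotatedCore_eq 1 0 1, ae_forall_rotatedCore_eq 1 1 0] with X hA hX h₁ h₂ h₃
  refine ⟨?_, fun Y hY => ?_⟩
  · rcases hX.lt_or_gt with hneg | hpos
    · have hG := mem_orbit_canonG3 hneg
      exact Or.inr ⟨hG, rank_eq_succ (isSumOfOuter_canonG3.of_mem_orbit hG)
        (not_isSumOfOuter_two_of_hyperdet_neg hneg)⟩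
    · have hG := mem_orbit_canonG2 hA hpos
      exact Or.inl ⟨hG, rank_eq_succ (isSumOfOuter_canonG2.of_mem_orbit hG)
        (not_isSumOfOuter_one_of_hyperdet_ne_zero hX)⟩
  · have hX0 : X ≠ 0 := by
      rintro rfl
      exact hX (by simp [hyperdet_eq])
    obtain ⟨θ, φ, ψ, s, a, b, c, d, hXc, hXY⟩ := hY.exists_core hX0
    have hp : X = rotatedCore ![![![s, θ], ![φ, a]], ![![ψ, b], ![c, d]]] := by
      rw [hXc]
      rfl
    have hD : X - Y ∈ orbit canonD3 := by
      rw [hXY]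
      exact transform_core_mem_orbit_canonD3 θ φ ψ (h₁ _ hp) (h₂ _ hp) (h₃ _ hp) d
    exact ⟨hD, invariants_of_mem_orbit_canonD3 hD⟩
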